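/- A \emph{time-oriented Lorentzian manifold} carries a smooth metric $g$ of signature $(-,+,\dots,+)$ and a time-orientation. Write $I^+(x)$ (resp. $I^-(x)$) for the set of endpoints (resp. starting points) of piecewise smooth future-directed timelike curves starting (resp. ending) at $x$. The manifold is \emph{past reflecting} if $q\in\overline{I^+(p)}$ implies $p\in\overline{I^-(q)}$ for all points $p,q$, \emph{future reflecting} if $q\in\overline{I^-(p)}$ implies $p\in\overline{I^+(q)}$ for all $p,q$, and \emph{reflecting} if it is both. It is \emph{distinguishing} if $I^+(p)=I^+(q)$ implies $p=q$ and $I^-(p)=I^-(q)$ implies $p=q$. It is \emph{causally continuous} if it is distinguishing and the maps $I^{\pm}$ are outer continuous, that is, for every point $p$ and every compact $K$ disjoint from $\overline{I^{\pm}(p)}$, $K$ is disjoint from $\overline{I^{\pm}(q)}$ for all $q$ in some neighbourhood of $p$. Let $M$ be the plane $\mathbb{R}^2$ with coordinates $(t,x)$, with the point $(0,0)$ and the points $(0,-1/k)$, $k=1,2,3,\dots$, removed, endowed with the restriction of the Minkowski metric $-dt^2+dx^2$ and of the time-orientation for which $\partial_t$ is future-directed. Let $p=(-1,1)$ and $q=(1,-1)$.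 Then: 1. $M$ is connected, causally continuous and reflecting; moreover $q\in\overline{I^+(p)}$ and $p\in\overline{I^-(q)}$ in $M$. 2. Let $\pi:\tilde M\to M$ be the universal Lorentzian covering, that is, any smooth covering by a simply connected time-oriented Lorentzian manifold that is a local isometry and preserves the time-orientation. For every $\tilde p\in\pi^{-1}(p)$ there is $\tilde q\in\pi^{-1}(q)$ such that $\tilde q\in\overline{\tilde I^+(\tilde p)}$ but $\tilde p\notin\overline{\tilde I^-(\tilde q)}$, where $\tilde I^{\pm}$ are the chronological future and past in $\tilde M$. In particular $\tilde M$ is not past reflecting. -/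

import Mathlib

open Set Filter Topology Manifold Bundle
open scoped ContDiff

noncomputable section

/-- The data and laws of a time-oriented Lorentzian manifold, signature `(-, +, …, +)`, on a
manifold `M` modelled on the vector space `E`: a smooth symmetric covariant 2-tensor field of
Lorentzian signature, and a continuous timelike vector field that fixes the future. -/
structure Spacetime (E : Type*) [NormedAddCommGroup E] [NormedSpace ℝ E] (M : Type*)
    [TopologicalSpace M] [ChartedSpace E M] [IsManifold 𝓘(ℝ, E) ∞ M] where
  metric : ∀ x : M, TangentSpace 𝓘(ℝ, E) x →L[ℝ] TangentSpace 𝓘(ℝ, E) x →L[ℝ] ℝ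
  symm : ∀ (x : M) (v w : TangentSpace 𝓘(ℝ, E) x), metric x v w = metric x w v
  timeField : ∀ x : M, TangentSpace 𝓘(ℝ, E) x
  timelike : ∀ x : M, metric x (timeField x) (timeField x) < 0
  pos_of_orthogonal : ∀ (x : M) (v : TangentSpace 𝓘(ℝ, E) x),
    metric x (timeField x) v = 0 → v ≠ 0 → 0 < metric x v v
  smooth : ContMDiff 𝓘(ℝ, E) (𝓘(ℝ, E).prod 𝓘(ℝ, E →L[ℝ] E →L[ℝ] ℝ)) ∞
    (fun x ↦ TotalSpace.mk' (E →L[ℝ] E →L[ℝ] ℝ) x (metric x))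
  continuous_timeField :
    Continuous (fun x ↦ (TotalSpace.mk' E x (timeField x) : TangentBundle 𝓘(ℝ, E) M))

namespace Spacetime

variable {E : Type*} [NormedAddCommGroup E] [NormedSpace ℝ E]
  {M : Type*} [TopologicalSpace M] [ChartedSpace E M] [IsManifold 𝓘(ℝ, E) ∞ M]
  {N : Type*} [TopologicalSpace N] [ChartedSpace E N] [IsManifold 𝓘(ℝ, E) ∞ N]

/-- `v` is a future-directed timelike tangent vector at `x`. -/
def IsFutureTimelike (S : Spacetime E M) (x : M) (v : TangentSpace 𝓘(ℝ, E) x) : Prop :=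
  S.metric x v v < 0 ∧ S.metric x (S.timeField x) v < 0

/-- There is a smooth future-directed timelike curve, defined on a compact interval,
from `x` to `y`. -/
def SmoothTimelikeCurve (S : Spacetime E M) (x y : M) : Prop :=
  ∃ (a b : ℝ) (γ : ℝ → M), a < b ∧ ContMDiffOn 𝓘(ℝ, ℝ) 𝓘(ℝ, E) ∞ γ (Icc a b) ∧
    γ a = x ∧ γ b = y ∧
    ∀ t ∈ Icc a b,
      S.IsFutureTimelike (γ t) (mfderivWithin 𝓘(ℝ, ℝ) 𝓘(ℝ, E) γ (Icc a b) t (1 : ℝ))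

/-- The chronological relation `x ≪ y`: there is a piecewise smooth future-directed timelike curve
(a finite, nonempty concatenation of smooth ones) from `x` to `y`. -/
def Chron (S : Spacetime E M) : M → M → Prop := Relation.TransGen S.SmoothTimelikeCurve

/-- The chronological future `I⁺(x)`. -/
def chronFuture (S : Spacetime E M) (x : M) : Set M := {y | S.Chron x y}

/-- The chronological past `I⁻(x)`. -/
def chronPast (S : Spacetime E M) (x : M) : Set M := {y | S.Chron y x}

def PastReflecting (S : Spacetime E M) : Prop :=
  ∀ p q : M, q ∈ closure (S.chronFuture p) → p ∈ closure (S.chronPast q)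

def FutureReflecting (S : Spacetime E M) : Prop :=
  ∀ p q : M, q ∈ closure (S.chronPast p) → p ∈ closure (S.chronFuture q)

def Reflecting (S : Spacetime E M) : Prop := S.PastReflecting ∧ S.FutureReflecting

/-- Past and future distinguishing. -/
def Distinguishing (S : Spacetime E M) : Prop :=
  (∀ p q : M, S.chronFuture p = S.chronFuture q → p = q) ∧
    ∀ p q : M, S.chronPast p = S.chronPast q → p = q

/-- A set-valued map `F` is outer continuous if, for each `p`, every compact set in the exterior
of `F p` is in the exterior of `F q` for all `q` near `p`. -/
def OuterContinuous (F : M → Set M) : Prop :=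
  ∀ (p : M) (K : Set M), IsCompact K → K ⊆ (closure (F p))ᶜ →
    ∀ᶠ q in 𝓝 p, K ⊆ (closure (F q))ᶜ

/-- A spacetime is causally continuous if it is distinguishing and `I⁺`, `I⁻` are outer
continuous. -/
def CausallyContinuous (S : Spacetime E M) : Prop :=
  S.Distinguishing ∧ OuterContinuous S.chronFuture ∧ OuterContinuous S.chronPast

/-- A (time-orientation preserving) Lorentzian covering: a smooth covering map that is a local
isometry and preserves the time-orientation. -/
structure IsLorentzCovering (S' : Spacetime E N) (S : Spacetime E M) (f : N → M) : Prop where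
  isCoveringMap : IsCoveringMap f
  surjective : Function.Surjective f
  isLocalDiffeomorph : IsLocalDiffeomorph 𝓘(ℝ, E) 𝓘(ℝ, E) ∞ f
  isometry : ∀ (x : N) (v w : TangentSpace 𝓘(ℝ, E) x),
    S'.metric x v w =
      S.metric (f x) (mfderiv 𝓘(ℝ, E) 𝓘(ℝ, E) f x v) (mfderiv 𝓘(ℝ, E) 𝓘(ℝ, E) f x w)
  future : ∀ (x : N) (v : TangentSpace 𝓘(ℝ, E) x),
    S'.IsFutureTimelike x v ↔
      S.IsFutureTimelike (f x) (mfderiv 𝓘(ℝ, E) 𝓘(ℝ, E) f x v)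

/-- The universal Lorentzian covering: a Lorentzian covering by a simply connected spacetime. -/
structure IsUniversalLorentzCovering (S' : Spacetime E N) (S : Spacetime E M) (f : N → M) : Prop
    extends IsLorentzCovering S' S f where
  simplyConnected : SimplyConnectedSpace N

end Spacetime

/-- The plane with coordinates `(t, x)`, `t = v 0` and `x = v 1`. -/
abbrev Plane : Type := EuclideanSpace ℝ (Fin 2)

/-- The Minkowski form `-dt² + dx²`. -/
def minkowskiForm : Plane →L[ℝ] Plane →L[ℝ] ℝ :=
  (EuclideanSpace.proj (𝕜 := ℝ) (1 : Fin 2)).smulRight (EuclideanSpace.proj (𝕜 := ℝ) (1 : Fin 2)) -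
  (EuclideanSpace.proj (𝕜 := ℝ) (0 : Fin 2)).smulRight (EuclideanSpace.proj (𝕜 := ℝ) (0 : Fin 2))

theorem minkowskiForm_apply (v w : Plane) : minkowskiForm v w = -(v 0 * w 0) + v 1 * w 1 := by
  simp [minkowskiForm]; ring

theorem opens_coordChange (U : TopologicalSpace.Opens Plane) (x₀ x : U) :
    fderivWithin ℝ ((chartAt Plane x₀).extend 𝓘(ℝ, Plane) ∘
      ((chartAt Plane x).extend 𝓘(ℝ, Plane)).symm) (range 𝓘(ℝ, Plane))
        ((chartAt Plane x).extend 𝓘(ℝ, Plane) x) = ContinuousLinearMap.id ℝ Plane := by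
  have h : (chartAt Plane x₀).extend 𝓘(ℝ, Plane) ∘
      ((chartAt Plane x).extend 𝓘(ℝ, Plane)).symm =ᶠ[𝓝 (x : Plane)] id := by
    filter_upwards [U.isOpen.mem_nhds x.2] with y hy
    have : Nonempty U := ⟨x⟩
    exact (U.openPartialHomeomorphSubtypeCoe this).right_inv (x := y) (by simpa using hy)
  have hx : (chartAt Plane x).extend 𝓘(ℝ, Plane) x = (x : Plane) := rfl
  rw [hx]
  simp only [modelWithCornersSelf_coe, range_id, fderivWithin_univ]
  rw [h.fderiv_eq, fderiv_id]

theorem opens_trivializationAt (U : TopologicalSpace.Opens Plane) (x₀ x : U)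
    (v : TangentSpace 𝓘(ℝ, Plane) x) :
    (trivializationAt Plane (TangentSpace 𝓘(ℝ, Plane)) x₀
      (TotalSpace.mk' Plane x v : TangentBundle 𝓘(ℝ, Plane) U)).2 = v :=
  congrArg (fun L : Plane →L[ℝ] Plane ↦ L v) (opens_coordChange U x₀ x)

theorem opens_mem_baseSet (U : TopologicalSpace.Opens Plane) (x₀ x : U) :
    x ∈ (trivializationAt Plane (TangentSpace 𝓘(ℝ, Plane)) x₀).baseSet := by
  rw [TangentBundle.trivializationAt_baseSet]
  change x ∈ (chartAt Plane x₀).source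
  rw [TopologicalSpace.Opens.chartAt_eq, OpenPartialHomeomorph.subtypeRestr_source]
  exact mem_univ (x : Plane)

theorem opens_trivializationAt_symm (U : TopologicalSpace.Opens Plane) (x₀ x : U) (v : Plane) :
    (trivializationAt Plane (TangentSpace 𝓘(ℝ, Plane)) x₀).symm x v = v := by
  let v' : TangentSpace 𝓘(ℝ, Plane) x := v
  exact (congrArg ((trivializationAt Plane (TangentSpace 𝓘(ℝ, Plane)) x₀).symm x)
    (opens_trivializationAt U x₀ x v').symm).trans
    ((trivializationAt Plane (TangentSpace 𝓘(ℝ, Plane)) x₀).symm_apply_apply_mk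
      (opens_mem_baseSet U x₀ x) v')

/-- On an open subset of a vector space, the inclusion identifies every tangent space with the
vector space, and this is the identity map in the representation of tangent vectors. -/
theorem mfderiv_opens_val (U : TopologicalSpace.Opens Plane) (x : U) :
    mfderiv 𝓘(ℝ, Plane) 𝓘(ℝ, Plane) (Subtype.val : U → Plane) x =
      ContinuousLinearMap.id ℝ Plane := by
  have h := opens_coordChange U x x
  have hd : MDifferentiableAt 𝓘(ℝ, Plane) 𝓘(ℝ, Plane) (Subtype.val : U → Plane) x :=
    (contMDiff_subtype_val (n := 1)).mdifferentiableAt (by simp)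
  exact (if_pos hd).trans h

/-- Minkowski spacetime restricted to an open subset of the plane: the metric is `-dt² + dx²`
and `∂ₜ` is future-directed. -/
def minkowskiOn (U : TopologicalSpace.Opens Plane) : Spacetime Plane U where
  metric _ := minkowskiForm
  symm _ v w := by
    refine (minkowskiForm_apply v w).trans (Eq.trans ?_ (minkowskiForm_apply w v).symm)
    ring
  timeField _ := (!₂[1, 0] : Plane)
  timelike _ := by
    refine (minkowskiForm_apply _ _).trans_lt ?_
    simp
  pos_of_orthogonal _ v h hv := by
    have h0 : -((!₂[1, 0] : Plane) 0 * (show Plane from v) 0) +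
        (!₂[1, 0] : Plane) 1 * (show Plane from v) 1 = 0 := (minkowskiForm_apply _ _).symm.trans h
    refine lt_of_lt_of_eq ?_ (minkowskiForm_apply v v).symm
    have h0' : (show Plane from v) 0 = 0 := by simpa using h0
    have h1' : (show Plane from v) 1 ≠ 0 := by
      intro h1
      refine hv (show (show Plane from v) = 0 from ?_)
      ext i
      fin_cases i
      · exact h0'
      · exact h1
    change 0 < -((show Plane from v) 0 * (show Plane from v) 0) +
      (show Plane from v) 1 * (show Plane from v) 1
    rw [h0']
    simpa using mul_self_pos.2 h1'
  smooth := by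
    refine fun x ↦ (contMDiffAt_section x).2 ?_
    convert! contMDiffAt_const (c := minkowskiForm) using 1
    funext y
    refine ContinuousLinearMap.ext fun v ↦ ContinuousLinearMap.ext fun w ↦ ?_
    refine (inCoordinates_apply_eq₂ (opens_mem_baseSet U x y) (opens_mem_baseSet U x y)
      (mem_univ _)).trans ?_
    rw [opens_trivializationAt_symm, opens_trivializationAt_symm]
    simp only [Trivial.fiberBundle_trivializationAt', Trivial.linearMapAt_trivialization]
    rfl
  continuous_timeField := by
    refine continuous_iff_continuousAt.2 fun x ↦ (FiberBundle.continuousAt_totalSpace _ _).2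
      ⟨continuousAt_id, ?_⟩
    exact (continuousAt_const (y := (!₂[1, 0] : Plane))).congr
      (Eventually.of_forall fun y ↦ (opens_trivializationAt U x y _).symm)

/-- The removed points: `(0, 0)` and `(0, -1/k)` for `k = 1, 2, …`. -/
def removedPoints : Set Plane :=
  {!₂[0, 0]} ∪ {v | ∃ k : ℕ, 1 ≤ k ∧ v = !₂[0, -1 / (k : ℝ)]}

theorem isClosed_removedPoints : IsClosed removedPoints := by
  have h : Tendsto (fun n : ℕ ↦ (!₂[0, -1 / ((n : ℝ) + 1)] : Plane)) atTop (𝓝 !₂[0, 0]) := by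
    have h1 : Tendsto (fun n : ℕ ↦ -1 / ((n : ℝ) + 1)) atTop (𝓝 0) := by
      simpa [neg_div] using (tendsto_one_div_add_atTop_nhds_zero_nat (𝕜 := ℝ)).neg
    have h2 : Continuous (fun a : ℝ ↦ (!₂[0, a] : Plane)) := by fun_prop
    exact (h2.tendsto 0).comp h1
  have := h.isCompact_insert_range.isClosed
  convert this using 1
  ext v
  simp only [removedPoints, mem_union, mem_singleton_iff, mem_ofPred_eq, mem_insert_iff, mem_range]
  refine or_congr Iff.rfl ⟨?_, ?_⟩
  · rintro ⟨k, hk, rfl⟩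
    obtain ⟨n, rfl⟩ := Nat.exists_eq_add_of_le' hk
    exact ⟨n, by push_cast; rfl⟩
  · rintro ⟨n, rfl⟩
    exact ⟨n + 1, by omega, by push_cast; rfl⟩

/-- The plane with the points `(0, 0)` and `(0, -1/k)`, `k ≥ 1`, removed. -/
def puncturedPlane : TopologicalSpace.Opens Plane :=
  ⟨removedPointsᶜ, isClosed_removedPoints.isOpen_compl⟩

/-- The plane with those points removed, with the restricted metric and time-orientation. -/
def puncturedMinkowski : Spacetime Plane puncturedPlane := minkowskiOn puncturedPlane

theorem mem_puncturedPlane_of_ne {v : Plane} (hv : v 0 ≠ 0) : v ∈ puncturedPlane := by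
  rintro (h | ⟨k, -, h⟩) <;> exact hv (by simp [show v = _ from h])

/-- The point `p = (-1, 1)`. -/
def pointP : puncturedPlane := ⟨!₂[-1, 1], mem_puncturedPlane_of_ne (by simp)⟩

/-- The point `q = (1, -1)`. -/
def pointQ : puncturedPlane := ⟨!₂[1, -1], mem_puncturedPlane_of_ne (by simp)⟩

end

/-! In M only countably many points are missing, so any two points that are chronologically related
in the Minkowski plane are joined in M by a broken timelike line dodging the holes
(`chron_of_minkowskiChron`). Hence chronology in M is that of Minkowski, the closures of I⁺ and I⁻
are given by the closed, antisymmetric relation `MinkowskiCausal`, and everything asserted about M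
follows.

In the cover the holes matter. The points p and q lie on the null line t + x = 0 through the removed
origin, and t + x increases along timelike curves. A curve leaving p therefore stays in t + x ≥ 0,
and a curve arriving at q stays in t + x ≤ 0: they pass the origin on opposite sides. A continuous
logarithm of `nullComplex` on the simply connected cover records the side, so no pair of lifts
satisfies both closure relations (`notMem_closure_chronPast`). One relation is realised by lifting
segments from p to points just above q; these avoid the half-line t = 0, x ≤ 0, which contains all
the holes (`exists_mem_closure_chronFuture`). The obstruction uses the origin alone. -/

noncomputable section

/-! ### Timelike curves under local diffeomorphisms and coverings. -/

section Curve

variable {E : Type*} [NormedAddCommGroup E] [NormedSpace ℝ E]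
  {M : Type*} [TopologicalSpace M] [ChartedSpace E M]
  {N : Type*} [TopologicalSpace N] [ChartedSpace E N]

theorem mfderivWithin_comp_curve {f : N → M} (hf : MDifferentiable 𝓘(ℝ, E) 𝓘(ℝ, E) f)
    {γ : ℝ → N} {a b t : ℝ} (hab : a < b)
    (hγ : ContMDiffOn 𝓘(ℝ, ℝ) 𝓘(ℝ, E) ∞ γ (Icc a b)) (ht : t ∈ Icc a b) :
    mfderivWithin 𝓘(ℝ, ℝ) 𝓘(ℝ, E) (f ∘ γ) (Icc a b) t (1 : ℝ) =
      mfderiv 𝓘(ℝ, E) 𝓘(ℝ, E) f (γ t)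
        (mfderivWithin 𝓘(ℝ, ℝ) 𝓘(ℝ, E) γ (Icc a b) t (1 : ℝ)) := by
  rw [mfderiv_comp_mfderivWithin (I' := 𝓘(ℝ, E)) t (hf (γ t))
    ((hγ t ht).mdifferentiableWithinAt (by simp))
    (uniqueMDiffWithinAt_iff_uniqueDiffWithinAt.2 (uniqueDiffOn_Icc hab t ht))]
  rfl

/-- Near each parameter γ is the local inverse of f applied to f ∘ γ; continuity of γ keeps it on
the right sheet. -/
theorem contMDiffOn_of_comp_isLocalDiffeomorph {f : N → M}
    (hf : IsLocalDiffeomorph 𝓘(ℝ, E) 𝓘(ℝ, E) ∞ f) {γ : ℝ → N} {s : Set ℝ}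
    (hγ : ContinuousOn γ s) (h : ContMDiffOn 𝓘(ℝ, ℝ) 𝓘(ℝ, E) ∞ (f ∘ γ) s) :
    ContMDiffOn 𝓘(ℝ, ℝ) 𝓘(ℝ, E) ∞ γ s := fun t ht ↦ by
  have h1 := (hf (γ t)).localInverse_contMDiffAt.comp_contMDiffWithinAt t (h t ht)
  refine h1.congr_of_eventuallyEq ?_ ?_
  · filter_upwards [(hγ t ht).eventually (hf (γ t)).localInverse_eventuallyEq_left] with s hs
    exact hs.symm
  · exact ((hf (γ t)).localInverse_eventuallyEq_left.self_of_nhds).symm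

end Curve

namespace Spacetime

variable {E : Type*} [NormedAddCommGroup E] [NormedSpace ℝ E]
  {M : Type*} [TopologicalSpace M] [ChartedSpace E M] [IsManifold 𝓘(ℝ, E) ∞ M]
  {N : Type*} [TopologicalSpace N] [ChartedSpace E N] [IsManifold 𝓘(ℝ, E) ∞ N]

/-- `γ` restricts to a smooth future-directed timelike curve on `[a, b]`. -/
structure IsTimelikeCurveOn (S : Spacetime E M) (γ : ℝ → M) (a b : ℝ) : Prop where
  lt : a < b
  contMDiffOn : ContMDiffOn 𝓘(ℝ, ℝ) 𝓘(ℝ, E) ∞ γ (Icc a b)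
  isFutureTimelike : ∀ t ∈ Icc a b,
    S.IsFutureTimelike (γ t) (mfderivWithin 𝓘(ℝ, ℝ) 𝓘(ℝ, E) γ (Icc a b) t (1 : ℝ))

theorem smoothTimelikeCurve_iff {S : Spacetime E M} {x y : M} :
    S.SmoothTimelikeCurve x y ↔ ∃ a b γ, S.IsTimelikeCurveOn γ a b ∧ γ a = x ∧ γ b = y :=
  ⟨fun ⟨a, b, γ, h, hγ, ha, hb, ht⟩ ↦ ⟨a, b, γ, ⟨h, hγ, ht⟩, ha, hb⟩,
    fun ⟨a, b, γ, ⟨h, hγ, ht⟩, ha, hb⟩ ↦ ⟨a, b, γ, h, hγ, ha, hb, ht⟩⟩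

theorem IsTimelikeCurveOn.smoothTimelikeCurve {S : Spacetime E M} {γ : ℝ → M} {a b : ℝ}
    (h : S.IsTimelikeCurveOn γ a b) : S.SmoothTimelikeCurve (γ a) (γ b) :=
  smoothTimelikeCurve_iff.2 ⟨a, b, γ, h, rfl, rfl⟩

theorem IsLorentzCovering.isTimelikeCurveOn_comp {S' : Spacetime E N} {S : Spacetime E M}
    {f : N → M} (hf : IsLorentzCovering S' S f) {γ : ℝ → N} {a b : ℝ}
    (h : S'.IsTimelikeCurveOn γ a b) : S.IsTimelikeCurveOn (f ∘ γ) a b where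
  lt := h.lt
  contMDiffOn := hf.isLocalDiffeomorph.contMDiff.comp_contMDiffOn h.contMDiffOn
  isFutureTimelike t ht := by
    rw [mfderivWithin_comp_curve (hf.isLocalDiffeomorph.mdifferentiable (by simp)) h.lt
      h.contMDiffOn ht]
    exact (hf.future _ _).1 (h.isFutureTimelike t ht)

theorem IsLorentzCovering.isTimelikeCurveOn_of_comp {S' : Spacetime E N} {S : Spacetime E M}
    {f : N → M} (hf : IsLorentzCovering S' S f) {γ : ℝ → N} {a b : ℝ}
    (hγ : ContinuousOn γ (Icc a b)) (h : S.IsTimelikeCurveOn (f ∘ γ) a b) :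
    S'.IsTimelikeCurveOn γ a b where
  lt := h.lt
  contMDiffOn := contMDiffOn_of_comp_isLocalDiffeomorph hf.isLocalDiffeomorph hγ h.contMDiffOn
  isFutureTimelike t ht := by
    rw [hf.future, ← mfderivWithin_comp_curve (hf.isLocalDiffeomorph.mdifferentiable (by simp)) h.lt
      (contMDiffOn_of_comp_isLocalDiffeomorph hf.isLocalDiffeomorph hγ h.contMDiffOn) ht]
    exact h.isFutureTimelike t ht

end Spacetime

/-! ### Timelike curves in open subsets of the Minkowski plane. -/

theorem minkowskiOn_isFutureTimelike {U : TopologicalSpace.Opens Plane} {x : U} {v : Plane} :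
    (minkowskiOn U).IsFutureTimelike x v ↔ |v 1| < v 0 := by
  have h : (minkowskiOn U).IsFutureTimelike x v ↔
      minkowskiForm v v < 0 ∧ minkowskiForm !₂[1, 0] v < 0 := Iff.rfl
  rw [h, minkowskiForm_apply, minkowskiForm_apply]
  simp only [Matrix.cons_val_zero, Matrix.cons_val_one]
  constructor
  · rintro ⟨h1, h2⟩
    exact abs_lt_of_sq_lt_sq (by nlinarith) (by linarith)
  · intro h
    have := abs_lt.1 h
    exact ⟨by nlinarith, by linarith⟩

theorem minkowskiOn_isTimelikeCurveOn {U : TopologicalSpace.Opens Plane} {γ : ℝ → U} {a b : ℝ} :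
    (minkowskiOn U).IsTimelikeCurveOn γ a b ↔
      a < b ∧ ContDiffOn ℝ ∞ (fun t ↦ (γ t : Plane)) (Icc a b) ∧ ∀ t ∈ Icc a b,
        |derivWithin (fun t ↦ (γ t : Plane)) (Icc a b) t 1| <
          derivWithin (fun t ↦ (γ t : Plane)) (Icc a b) t 0 := by
  have h1 : ContMDiffOn 𝓘(ℝ, ℝ) 𝓘(ℝ, Plane) ∞ γ (Icc a b) ↔
      ContDiffOn ℝ ∞ (fun t ↦ (γ t : Plane)) (Icc a b) := by
    rw [← contMDiffOn_iff_contDiffOn]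
    exact forall₂_congr fun t _ ↦ (ContMDiffWithinAt.subtypeVal_comp_iff U γ _ t).symm
  have h2 (hab : a < b) (hγ : ContMDiffOn 𝓘(ℝ, ℝ) 𝓘(ℝ, Plane) ∞ γ (Icc a b)) (t : ℝ)
      (ht : t ∈ Icc a b) : derivWithin (fun t ↦ (γ t : Plane)) (Icc a b) t =
        mfderivWithin 𝓘(ℝ, ℝ) 𝓘(ℝ, Plane) γ (Icc a b) t (1 : ℝ) := by
    have := mfderivWithin_comp_curve (f := (Subtype.val : U → Plane))
      ((contMDiff_subtype_val (n := 1)).mdifferentiable (by simp)) hab hγ ht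
    rw [mfderiv_opens_val, mfderivWithin_eq_fderivWithin] at this
    rw [← fderivWithin_derivWithin]
    exact this
  refine ⟨fun ⟨hab, hγ, h⟩ ↦ ⟨hab, h1.1 hγ, fun t ht ↦ ?_⟩,
    fun ⟨hab, hγ, h⟩ ↦ ⟨hab, h1.2 hγ, fun t ht ↦ ?_⟩⟩
  · rw [h2 hab hγ t ht]
    exact minkowskiOn_isFutureTimelike.1 (h t ht)
  · refine minkowskiOn_isFutureTimelike.2 ?_
    rw [← h2 hab (h1.2 hγ) t ht]
    exact h t ht

/-- With c = ±1 these are the two null coordinates; their derivative is positive because the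
t-component of the velocity exceeds the absolute value of the x-component. -/
theorem strictMonoOn_add_of_isTimelikeCurveOn {U : TopologicalSpace.Opens Plane} {γ : ℝ → U}
    {a b : ℝ} (h : (minkowskiOn U).IsTimelikeCurveOn γ a b) {c : ℝ} (hc : |c| = 1) :
    StrictMonoOn (fun t ↦ (γ t : Plane) 0 + c * (γ t : Plane) 1) (Icc a b) := by
  obtain ⟨hab, hγ, hd⟩ := minkowskiOn_isTimelikeCurveOn.1 h
  let φ : Plane →L[ℝ] ℝ := EuclideanSpace.proj (0 : Fin 2) + c • EuclideanSpace.proj (1 : Fin 2)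
  have hφ : (fun t ↦ (γ t : Plane) 0 + c * (γ t : Plane) 1) = fun t ↦ φ (γ t) := by
    ext t; simp [φ]
  rw [hφ]
  refine strictMonoOn_of_deriv_pos (convex_Icc a b)
    (φ.continuous.comp_continuousOn hγ.continuousOn) fun t ht ↦ ?_
  have ht' := interior_subset ht
  have hd1 := (hγ.differentiableOn (by simp) t ht').hasDerivWithinAt
  have hd2 := (φ.hasFDerivAt.comp_hasDerivWithinAt t hd1).hasDerivAt (mem_interior_iff_mem_nhds.1 ht)
  have h3 := hd t ht'
  change 0 < deriv (φ ∘ fun t ↦ (γ t : Plane)) t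
  rw [hd2.deriv]
  rw [show φ (derivWithin (fun t ↦ (γ t : Plane)) (Icc a b) t) =
    derivWithin (fun t ↦ (γ t : Plane)) (Icc a b) t 0 +
      c * derivWithin (fun t ↦ (γ t : Plane)) (Icc a b) t 1 by simp [φ]]
  have h4 := neg_abs_le (c * derivWithin (fun t ↦ (γ t : Plane)) (Icc a b) t 1)
  rw [abs_mul, hc, one_mul] at h4
  linarith

/-! ### Chronology of the plane with countably many points removed. -/

/-- The chronological relation of the Minkowski plane. -/
def MinkowskiChron (a b : Plane) : Prop := |b 1 - a 1| < b 0 - a 0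

/-- The causal relation of the Minkowski plane. -/
def MinkowskiCausal (a b : Plane) : Prop := |b 1 - a 1| ≤ b 0 - a 0

theorem MinkowskiChron.trans {a b c : Plane} (hab : MinkowskiChron a b)
    (hbc : MinkowskiChron b c) : MinkowskiChron a c := by
  unfold MinkowskiChron at *
  rw [abs_lt] at *
  constructor <;> linarith [hab.1, hab.2, hbc.1, hbc.2]

theorem isTimelikeCurveOn_of_eqOn_lineMap {U : TopologicalSpace.Opens Plane} {a b : Plane}
    (hab : MinkowskiChron a b) {γ : ℝ → U}
    (hγ : EqOn (fun s ↦ (γ s : Plane)) (AffineMap.lineMap a b) (Icc 0 1)) :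
    (minkowskiOn U).IsTimelikeCurveOn γ 0 1 := by
  refine minkowskiOn_isTimelikeCurveOn.2 ⟨zero_lt_one, ?_, fun t ht ↦ ?_⟩
  · exact ContDiffOn.congr (f := AffineMap.lineMap a b) (by fun_prop) hγ
  · have : derivWithin (fun s ↦ (γ s : Plane)) (Icc 0 1) t = b - a := by
      rw [derivWithin_congr hγ (hγ ht)]
      exact AffineMap.hasDerivWithinAt_lineMap.derivWithin (uniqueDiffOn_Icc zero_lt_one t ht)
    rw [this]
    exact hab

theorem smoothTimelikeCurve_of_segment_subset {U : TopologicalSpace.Opens Plane} {a b : U}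
    (hab : MinkowskiChron a b) (h : segment ℝ (a : Plane) b ⊆ U) :
    (minkowskiOn U).SmoothTimelikeCurve a b := by
  classical
  rw [segment_eq_image_lineMap] at h
  -- Outside [0, 1] the line may leave U; the value `a` there is arbitrary.
  let γ : ℝ → U := fun s ↦
    if hs : AffineMap.lineMap (a : Plane) (b : Plane) s ∈ U then ⟨_, hs⟩ else a
  have hγ : EqOn (fun s ↦ (γ s : Plane)) (AffineMap.lineMap (a : Plane) (b : Plane))
      (Icc 0 1) := fun s hs ↦ by
    have : AffineMap.lineMap (a : Plane) (b : Plane) s ∈ U := h (mem_image_of_mem _ hs)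
    simp [γ, this]
  refine Spacetime.smoothTimelikeCurve_iff.2
    ⟨0, 1, γ, isTimelikeCurveOn_of_eqOn_lineMap hab hγ, Subtype.ext ?_, Subtype.ext ?_⟩
  · simpa using hγ (left_mem_Icc.2 zero_le_one)
  · simpa using hγ (right_mem_Icc.2 zero_le_one)

theorem minkowskiChron_of_chron {U : TopologicalSpace.Opens Plane} {a b : U}
    (h : (minkowskiOn U).Chron a b) : MinkowskiChron a b := by
  have key {x y : U} (hxy : (minkowskiOn U).SmoothTimelikeCurve x y) : MinkowskiChron x y := by
    obtain ⟨s, t, γ, hγ, rfl, rfl⟩ := Spacetime.smoothTimelikeCurve_iff.1 hxy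
    have hs := left_mem_Icc.2 hγ.lt.le
    have ht := right_mem_Icc.2 hγ.lt.le
    have h1 := strictMonoOn_add_of_isTimelikeCurveOn hγ (c := 1) (by simp) hs ht hγ.lt
    have h2 := strictMonoOn_add_of_isTimelikeCurveOn hγ (c := -1) (by simp) hs ht hγ.lt
    simp only at h1 h2
    exact abs_lt.2 ⟨by linarith, by linarith⟩
  induction h with
  | single h => exact key h
  | tail _ h ih => exact ih.trans (key h)

/-- The line through a and r meets the line t = `m.1` in at most one point. So each hole spoils at
most one choice of break point. -/
theorem subsingleton_mem_segment_left {a r : Plane} (hr : r ≠ a) {m : ℝ × ℝ} (hm : a 0 ≠ m.1) :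
    {s : ℝ | r ∈ segment ℝ a !₂[m.1, m.2 + s]}.Subsingleton := by
  intro s hs s' hs'
  simp only [segment_eq_image_lineMap, mem_ofPred_eq, mem_image] at hs hs'
  obtain ⟨l, -, rfl⟩ := hs
  obtain ⟨l', -, h⟩ := hs'
  have h0 := congrArg (fun v : Plane ↦ v 0) h
  have h1 := congrArg (fun v : Plane ↦ v 1) h
  simp only [AffineMap.lineMap_apply, vsub_eq_sub, vadd_eq_add, PiLp.add_apply, PiLp.smul_apply,
    PiLp.sub_apply, Matrix.cons_val_zero, Matrix.cons_val_one, smul_eq_mul, add_left_inj] at h0 h1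
  obtain rfl : l' = l := mul_right_cancel₀ (sub_ne_zero.2 hm.symm) h0
  have hl : l' ≠ 0 := by
    rintro rfl
    simp at hr
  have := mul_left_cancel₀ hl h1
  linarith

/-- Break the segment at its midpoint, shifted in the x-direction by a small s. Only countably many
s make either half hit a hole, so a good s exists. -/
theorem chron_of_minkowskiChron {U : TopologicalSpace.Opens Plane}
    (hU : (U : Set Plane)ᶜ.Countable) {a b : U} (h : MinkowskiChron a b) :
    (minkowskiOn U).Chron a b := by
  have hab := h
  unfold MinkowskiChron at h
  let m : ℝ × ℝ := (((a : Plane) 0 + (b : Plane) 0) / 2, ((a : Plane) 1 + (b : Plane) 1) / 2)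
  -- Each half has displacement (Δt/2, Δx/2 ± s), which is timelike as soon as |s| < (Δt - |Δx|)/2.
  let δ : ℝ := ((b : Plane) 0 - (a : Plane) 0 - |(b : Plane) 1 - (a : Plane) 1|) / 2
  have hδ : 0 < δ := by simp only [δ]; linarith
  have h0 : (a : Plane) 0 < (b : Plane) 0 := by linarith [abs_nonneg ((b : Plane) 1 - (a : Plane) 1)]
  let bad : Set ℝ := ⋃ r ∈ (U : Set Plane)ᶜ, ({s : ℝ | r ∈ segment ℝ (a : Plane) !₂[m.1, m.2 + s]} ∪
    {s : ℝ | r ∈ segment ℝ (b : Plane) !₂[m.1, m.2 + s]})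
  have hbad : bad.Countable := hU.biUnion fun r hr ↦
    ((subsingleton_mem_segment_left (fun hra ↦ hr (by rw [hra]; exact a.2))
      (by simp only [m]; linarith : (a : Plane) 0 < m.1).ne).countable).union
    ((subsingleton_mem_segment_left (fun hrb ↦ hr (by rw [hrb]; exact b.2))
      (by simp only [m]; linarith : m.1 < (b : Plane) 0).ne').countable)
  obtain ⟨s, hs, hsδ⟩ := (hbad.dense_compl ℝ).exists_mem_open (isOpen_Ioo (a := -δ) (b := δ))
    ⟨0, by simpa using hδ⟩
  have hs1 : segment ℝ (a : Plane) !₂[m.1, m.2 + s] ⊆ U := fun r hr ↦ by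
    by_contra hrU
    exact hs (mem_iUnion₂.2 ⟨r, hrU, Or.inl hr⟩)
  have hs2 : segment ℝ (b : Plane) !₂[m.1, m.2 + s] ⊆ U := fun r hr ↦ by
    by_contra hrU
    exact hs (mem_iUnion₂.2 ⟨r, hrU, Or.inr hr⟩)
  let z : U := ⟨!₂[m.1, m.2 + s], hs1 (right_mem_segment ..)⟩
  have h1 := neg_abs_le ((b : Plane) 1 - (a : Plane) 1)
  have h2 := le_abs_self ((b : Plane) 1 - (a : Plane) 1)
  simp only [mem_Ioo, δ] at hsδ
  refine .tail (b := z) (.single (smoothTimelikeCurve_of_segment_subset ?_ hs1))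
    (smoothTimelikeCurve_of_segment_subset ?_ (segment_symm ℝ (b : Plane) _ ▸ hs2))
  · simp only [MinkowskiChron, z, m, Matrix.cons_val_zero, Matrix.cons_val_one]
    exact abs_lt.2 ⟨by linarith, by linarith⟩
  · simp only [MinkowskiChron, z, m, Matrix.cons_val_zero, Matrix.cons_val_one]
    exact abs_lt.2 ⟨by linarith, by linarith⟩

theorem countable_removedPoints : removedPoints.Countable := by
  refine (countable_singleton _).union ((countable_range fun k : ℕ ↦
    (!₂[0, -1 / (k : ℝ)] : Plane)).mono ?_)
  rintro v ⟨k, -, rfl⟩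
  exact ⟨k, rfl⟩

theorem connectedSpace_puncturedPlane : ConnectedSpace puncturedPlane :=
  isConnected_iff_connectedSpace.1
    (countable_removedPoints.isConnected_compl_of_one_lt_rank (by
      rw [← Module.finrank_eq_rank, finrank_euclideanSpace_fin]; norm_num))

/-! ### Reflectivity and causal continuity when countably many points are removed. -/

section Countable

variable {U : TopologicalSpace.Opens Plane}

theorem chron_iff (hU : (U : Set Plane)ᶜ.Countable) {a b : U} :
    (minkowskiOn U).Chron a b ↔ MinkowskiChron a b :=
  ⟨minkowskiChron_of_chron, chron_of_minkowskiChron hU⟩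

theorem isClosed_minkowskiCausal : IsClosed {x : Plane × Plane | MinkowskiCausal x.1 x.2} :=
  isClosed_le (by fun_prop) (by fun_prop)

theorem MinkowskiChron.causal {a b : Plane} (h : MinkowskiChron a b) : MinkowskiCausal a b :=
  le_of_lt h

theorem eventually_add_time_mem (y : U) (c : ℝ) :
    ∀ᶠ ε : ℝ in 𝓝[>] 0, (y : Plane) + ε • !₂[c, 0] ∈ U := by
  have : Tendsto (fun ε : ℝ ↦ (y : Plane) + ε • (!₂[c, 0] : Plane)) (𝓝 0) (𝓝 y) := by
    have : Continuous (fun ε : ℝ ↦ (y : Plane) + ε • (!₂[c, 0] : Plane)) := by fun_prop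
    simpa using this.tendsto 0
  exact (this.mono_left nhdsWithin_le_nhds).eventually (U.isOpen.mem_nhds y.2)

/-- Moving a point slightly in the direction of `c • ∂ₜ` stays close to it. -/
theorem mem_closure_of_forall_add_time {A : Set U} {y : U} (c : ℝ)
    (h : ∀ z : U, ∀ ε : ℝ, 0 < ε → (z : Plane) = (y : Plane) + ε • !₂[c, 0] → z ∈ A) : y ∈ closure A := by
  rw [closure_subtype]
  have : Tendsto (fun ε : ℝ ↦ (y : Plane) + ε • (!₂[c, 0] : Plane)) (𝓝 0) (𝓝 y) := by
    have : Continuous (fun ε : ℝ ↦ (y : Plane) + ε • (!₂[c, 0] : Plane)) := by fun_prop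
    simpa using this.tendsto 0
  refine mem_closure_of_tendsto (this.mono_left (nhdsWithin_le_nhds (s := Ioi 0))) ?_
  filter_upwards [eventually_add_time_mem y c, self_mem_nhdsWithin] with ε hε hpos
  exact ⟨⟨_, hε⟩, h _ ε hpos rfl, rfl⟩

/-- The causal relation is closed and contains the chronological one; conversely, moving b forward
in time by any ε > 0 makes a causal pair chronological. -/
theorem mem_closure_chronFuture_iff (hU : (U : Set Plane)ᶜ.Countable) {a b : U} :
    b ∈ closure ((minkowskiOn U).chronFuture a) ↔ MinkowskiCausal a b := by
  constructor
  · intro h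
    refine closure_minimal (t := {b : U | MinkowskiCausal a b})
      (fun z hz ↦ ((chron_iff hU).1 hz).causal) ?_ h
    exact isClosed_minkowskiCausal.preimage (f := fun b : U ↦ ((a : Plane), (b : Plane)))
      (by fun_prop)
  · intro h
    refine mem_closure_of_forall_add_time 1 fun z ε hε hz ↦ (chron_iff hU).2 ?_
    unfold MinkowskiCausal at h
    simp only [MinkowskiChron, hz, PiLp.add_apply, PiLp.smul_apply, Matrix.cons_val_zero,
      Matrix.cons_val_one, smul_eq_mul, mul_one, mul_zero, add_zero]
    linarith

theorem mem_closure_chronPast_iff (hU : (U : Set Plane)ᶜ.Countable) {a b : U} :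
    a ∈ closure ((minkowskiOn U).chronPast b) ↔ MinkowskiCausal a b := by
  constructor
  · intro h
    refine closure_minimal (t := {a : U | MinkowskiCausal a b})
      (fun z hz ↦ ((chron_iff hU).1 hz).causal) ?_ h
    exact isClosed_minkowskiCausal.preimage (f := fun a : U ↦ ((a : Plane), (b : Plane)))
      (by fun_prop)
  · intro h
    refine mem_closure_of_forall_add_time (-1) fun z ε hε hz ↦ (chron_iff hU).2 ?_
    unfold MinkowskiCausal at h
    simp only [MinkowskiChron, hz, PiLp.add_apply, PiLp.smul_apply, Matrix.cons_val_zero,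
      Matrix.cons_val_one, smul_eq_mul, mul_neg, mul_one, mul_zero, add_zero]
    linarith

theorem MinkowskiCausal.refl (a : Plane) : MinkowskiCausal a a := by simp [MinkowskiCausal]

theorem MinkowskiCausal.antisymm {a b : Plane} (hab : MinkowskiCausal a b)
    (hba : MinkowskiCausal b a) : a = b := by
  unfold MinkowskiCausal at *
  rw [abs_le] at *
  ext i
  fin_cases i
  · change a 0 = b 0
    linarith [hab.1, hab.2, hba.1, hba.2]
  · change a 1 = b 1
    linarith [hab.1, hab.2, hba.1, hba.2]

theorem minkowskiOn_reflecting (hU : (U : Set Plane)ᶜ.Countable) : (minkowskiOn U).Reflecting :=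
  ⟨fun _ _ h ↦ (mem_closure_chronPast_iff hU).2 ((mem_closure_chronFuture_iff hU).1 h),
    fun _ _ h ↦ (mem_closure_chronFuture_iff hU).2 ((mem_closure_chronPast_iff hU).1 h)⟩

/-- The closure of I⁺ or of I⁻ recovers the causal relation, which is reflexive and antisymmetric.
-/
theorem minkowskiOn_distinguishing (hU : (U : Set Plane)ᶜ.Countable) :
    (minkowskiOn U).Distinguishing := by
  refine ⟨fun p q h ↦ Subtype.ext ?_, fun p q h ↦ Subtype.ext ?_⟩
  · have h1 (z : U) : MinkowskiCausal p z ↔ MinkowskiCausal q z := by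
      rw [← mem_closure_chronFuture_iff hU, h, mem_closure_chronFuture_iff hU]
    exact ((h1 q).2 (.refl _)).antisymm ((h1 p).1 (.refl _))
  · have h1 (z : U) : MinkowskiCausal z p ↔ MinkowskiCausal z q := by
      rw [← mem_closure_chronPast_iff hU, h, mem_closure_chronPast_iff hU]
    exact ((h1 p).1 (.refl _)).antisymm ((h1 q).2 (.refl _))

/-- Tube lemma: the complement of the closed graph is an open neighbourhood of {p} × K. -/
theorem outerContinuous_of_isClosed {X : Type*} [TopologicalSpace X] {F : X → Set X}
    (h : IsClosed {x : X × X | x.2 ∈ closure (F x.1)}) : Spacetime.OuterContinuous F :=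
  fun p _ hK hKp ↦ hK.eventually_forall_of_forall_eventually fun y hy ↦
    h.isOpen_compl.mem_nhds (x := (p, y)) (hKp hy)

theorem minkowskiOn_causallyContinuous (hU : (U : Set Plane)ᶜ.Countable) :
    (minkowskiOn U).CausallyContinuous := by
  refine ⟨minkowskiOn_distinguishing hU, outerContinuous_of_isClosed ?_,
    outerContinuous_of_isClosed ?_⟩
  · simp only [mem_closure_chronFuture_iff hU]
    exact isClosed_minkowskiCausal.preimage (f := fun x : U × U ↦ ((x.1 : Plane), (x.2 : Plane)))
      (by fun_prop)
  · simp only [mem_closure_chronPast_iff hU]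
    exact isClosed_minkowskiCausal.preimage (f := fun x : U × U ↦ ((x.2 : Plane), (x.1 : Plane)))
      (by fun_prop)

end Countable

theorem countable_compl_puncturedPlane : (puncturedPlane : Set Plane)ᶜ.Countable := by
  simpa [puncturedPlane] using countable_removedPoints

theorem minkowskiCausal_pointP_pointQ : MinkowskiCausal pointP pointQ := by
  simp only [MinkowskiCausal, pointP, pointQ, Matrix.cons_val_zero, Matrix.cons_val_one]
  norm_num

/-! ### The logarithm that tells the two sides of the origin apart. -/

/-- The null coordinates `-(t + x)` and `x - t`, as a complex number. -/
def nullComplex (v : Plane) : ℂ := ⟨-(v 0 + v 1), v 1 - v 0⟩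

theorem continuous_nullComplex : Continuous nullComplex := by
  have : nullComplex = fun v ↦ ((-(v 0 + v 1) : ℝ) : ℂ) + ((v 1 - v 0 : ℝ) : ℂ) * Complex.I := by
    ext v
    apply Complex.ext <;> simp [nullComplex]
  rw [this]
  fun_prop

theorem nullComplex_ne_zero (x : puncturedPlane) : nullComplex x ≠ 0 := by
  intro h
  have hre : -((x : Plane) 0 + (x : Plane) 1) = 0 := congrArg Complex.re h
  have him : (x : Plane) 1 - (x : Plane) 0 = 0 := congrArg Complex.im h
  refine x.2 (Or.inl (show (x : Plane) = !₂[0, 0] from ?_))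
  ext i
  fin_cases i
  · change (x : Plane) 0 = 0
    linarith
  · change (x : Plane) 1 = 0
    linarith

/-- The half-plane t + x ≤ 0 becomes Re ≥ 0, which misses the branch cut except at the removed
origin. On the other half-plane the same holds after a change of sign. -/
theorem nullComplex_mem_slitPlane {x : puncturedPlane} (h : (x : Plane) 0 + (x : Plane) 1 ≤ 0) :
    nullComplex x ∈ Complex.slitPlane := by
  rw [Complex.mem_slitPlane_iff]
  by_contra! hc
  refine nullComplex_ne_zero x (Complex.ext (le_antisymm hc.1 ?_) hc.2)
  exact neg_nonneg.2 h

theorem neg_nullComplex_mem_slitPlane {x : puncturedPlane}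
    (h : 0 ≤ (x : Plane) 0 + (x : Plane) 1) : -nullComplex x ∈ Complex.slitPlane := by
  rw [Complex.mem_slitPlane_iff]
  by_contra! hc
  exact nullComplex_ne_zero x (Complex.ext (le_antisymm (neg_nonpos.2 h) (neg_nonpos.1 hc.1))
    (neg_eq_zero.1 hc.2))

theorem nullComplex_pointP : nullComplex pointP = 2 * Complex.I := by
  apply Complex.ext <;> simp [nullComplex, pointP]
  norm_num

theorem nullComplex_pointQ : nullComplex pointQ = -(2 * Complex.I) := by
  apply Complex.ext <;> simp [nullComplex, pointQ]
  norm_num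

theorem eq_of_mem_closure_of_forall_eq {X Y : Type*} [TopologicalSpace X] [TopologicalSpace Y]
    [T1Space Y] {g : X → Y} {s : Set X} {x : X} {y : Y} (hg : ContinuousAt g x)
    (hx : x ∈ closure s) (h : ∀ z ∈ s, g z = y) : g x = y := by
  have h1 := mem_closure_image hg hx
  have h2 : g '' s ⊆ {y} := by
    rintro _ ⟨z, hz, rfl⟩
    exact h z hz
  simpa using closure_mono h2 h1

section Lift

variable {N : Type*} [TopologicalSpace N]

/-- The exponential covers ℂ ∖ {0}, so the nonvanishing function lifts through it from a simply
connected space. -/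
theorem exists_exp_eq_nullComplex [SimplyConnectedSpace N] [LocallyPathConnectedSpace N]
    {f : N → puncturedPlane} (hf : Continuous f) :
    ∃ L : C(N, ℂ), ∀ n, Complex.exp (L n) = nullComplex (f n) := by
  obtain ⟨n₀⟩ : Nonempty N := inferInstance
  obtain ⟨L, ⟨-, hL⟩, -⟩ := Complex.isCoveringMapOn_exp.existsUnique_continuousMap_lifts
    (⟨fun n ↦ nullComplex (f n),
      continuous_nullComplex.comp (continuous_subtype_val.comp hf)⟩ : C(N, ℂ))
    (a₀ := n₀) (Complex.exp_log (nullComplex_ne_zero _)) (fun n ↦ nullComplex_ne_zero (f n))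
  exact ⟨L, fun n ↦ congrFun hL n⟩

/-- On a preconnected set that `c * g` maps into the slit plane, a continuous logarithm of `g`
differs from the principal logarithm of `c * g` by a constant. -/
theorem sub_log_eq_of_isPreconnected {X : Type*} [TopologicalSpace X] {s : Set X}
    (hs : IsPreconnected s) {l g : X → ℂ} {c : ℂ} (hl : ContinuousOn l s) (hg : ContinuousOn g s)
    (hlg : ∀ x ∈ s, Complex.exp (l x) = g x) (hc : ∀ x ∈ s, c * g x ∈ Complex.slitPlane)
    {x y : X} (hx : x ∈ s) (hy : y ∈ s) :
    l x - Complex.log (c * g x) = l y - Complex.log (c * g y) := by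
  -- The difference takes values in one fibre of the covering `exp`, so it is constant on a
  -- preconnected set.
  have key (x : X) (hx : x ∈ s) : Complex.exp (l x - Complex.log (c * g x)) = c⁻¹ := by
    have h0 := Complex.slitPlane_ne_zero (hc x hx)
    rw [Complex.exp_sub, Complex.exp_log h0, hlg x hx, div_eq_iff h0,
      inv_mul_cancel_left₀ (left_ne_zero_of_mul h0)]
  refine Complex.isCoveringMap_exp.constOn_of_comp hs
    (g := fun x ↦ l x - Complex.log (c * g x))
    (hl.sub ((continuousOn_const.mul hg).clog hc)) (fun x hx y hy ↦ Subtype.ext ?_) hx hy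
  exact (key x hx).trans (key y hy).symm

variable [ChartedSpace Plane N] [IsManifold 𝓘(ℝ, Plane) ∞ N] {S : Spacetime Plane N}
  {f : N → puncturedPlane}

theorem sub_log_eq_of_isTimelikeCurveOn {L : C(N, ℂ)} (hf : Continuous f)
    (hL : ∀ n, Complex.exp (L n) = nullComplex (f n)) {γ : ℝ → N} {a b : ℝ} (c : ℂ)
    (hγ : S.IsTimelikeCurveOn γ a b)
    (hc : ∀ t ∈ Icc a b, c * nullComplex (f (γ t)) ∈ Complex.slitPlane) :
    L (γ a) - Complex.log (c * nullComplex (f (γ a))) =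
      L (γ b) - Complex.log (c * nullComplex (f (γ b))) :=
  sub_log_eq_of_isPreconnected isPreconnected_Icc
    (l := fun t ↦ L (γ t)) (g := fun t ↦ nullComplex (f (γ t)))
    (L.continuous.comp_continuousOn hγ.contMDiffOn.continuousOn)
    ((continuous_nullComplex.comp (continuous_subtype_val.comp hf)).comp_continuousOn
      hγ.contMDiffOn.continuousOn) (fun t _ ↦ hL (γ t)) hc
    (left_mem_Icc.2 hγ.lt.le) (right_mem_Icc.2 hγ.lt.le)

theorem strictMonoOn_of_isLorentzCovering
    (hf : Spacetime.IsLorentzCovering S puncturedMinkowski f) {γ : ℝ → N} {a b : ℝ}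
    (hγ : S.IsTimelikeCurveOn γ a b) :
    StrictMonoOn (fun t ↦ (f (γ t) : Plane) 0 + (f (γ t) : Plane) 1) (Icc a b) := by
  simpa using strictMonoOn_add_of_isTimelikeCurveOn (hf.isTimelikeCurveOn_comp hγ) (c := 1) (by simp)

theorem sub_log_eq_of_chron_of_nonpos (hf : Spacetime.IsLorentzCovering S puncturedMinkowski f)
    {L : C(N, ℂ)} (hL : ∀ n, Complex.exp (L n) = nullComplex (f n)) {r s : N} (h : S.Chron r s)
    (hs : (f s : Plane) 0 + (f s : Plane) 1 ≤ 0) :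
    (f r : Plane) 0 + (f r : Plane) 1 ≤ 0 ∧
      L r - Complex.log (nullComplex (f r)) = L s - Complex.log (nullComplex (f s)) := by
  have key {r s : N} (h : S.SmoothTimelikeCurve r s)
      (hs : (f s : Plane) 0 + (f s : Plane) 1 ≤ 0) :
      (f r : Plane) 0 + (f r : Plane) 1 ≤ 0 ∧
        L r - Complex.log (nullComplex (f r)) = L s - Complex.log (nullComplex (f s)) := by
    obtain ⟨a, b, γ, hγ, rfl, rfl⟩ := Spacetime.smoothTimelikeCurve_iff.1 h
    have hm := (strictMonoOn_of_isLorentzCovering hf hγ).monotoneOn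
    have hle (t : ℝ) (ht : t ∈ Icc a b) : (f (γ t) : Plane) 0 + (f (γ t) : Plane) 1 ≤ 0 :=
      (hm ht (right_mem_Icc.2 hγ.lt.le) ht.2).trans hs
    refine ⟨hle a (left_mem_Icc.2 hγ.lt.le), ?_⟩
    simpa using sub_log_eq_of_isTimelikeCurveOn hf.isCoveringMap.continuous hL 1 hγ
      fun t ht ↦ by simpa using nullComplex_mem_slitPlane (hle t ht)
  -- The bound t + x ≤ 0 is known at the final point and propagates backwards, hence induction from
  -- the head.
  induction h using Relation.TransGen.head_induction_on with
  | single h => exact key h hs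
  | head h _ ih => exact ⟨(key h ih.1).1, (key h ih.1).2.trans ih.2⟩

theorem sub_log_neg_eq_of_chron_of_nonneg
    (hf : Spacetime.IsLorentzCovering S puncturedMinkowski f)
    {L : C(N, ℂ)} (hL : ∀ n, Complex.exp (L n) = nullComplex (f n)) {r s : N} (h : S.Chron r s)
    (hr : 0 ≤ (f r : Plane) 0 + (f r : Plane) 1) :
    0 ≤ (f s : Plane) 0 + (f s : Plane) 1 ∧
      L s - Complex.log (-nullComplex (f s)) = L r - Complex.log (-nullComplex (f r)) := by
  have key {r s : N} (h : S.SmoothTimelikeCurve r s)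
      (hr : 0 ≤ (f r : Plane) 0 + (f r : Plane) 1) :
      0 ≤ (f s : Plane) 0 + (f s : Plane) 1 ∧
        L s - Complex.log (-nullComplex (f s)) = L r - Complex.log (-nullComplex (f r)) := by
    obtain ⟨a, b, γ, hγ, rfl, rfl⟩ := Spacetime.smoothTimelikeCurve_iff.1 h
    have hm := (strictMonoOn_of_isLorentzCovering hf hγ).monotoneOn
    have hle (t : ℝ) (ht : t ∈ Icc a b) : 0 ≤ (f (γ t) : Plane) 0 + (f (γ t) : Plane) 1 :=
      hr.trans (hm (left_mem_Icc.2 hγ.lt.le) ht ht.1)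
    refine ⟨hle b (right_mem_Icc.2 hγ.lt.le), ?_⟩
    simpa using (sub_log_eq_of_isTimelikeCurveOn hf.isCoveringMap.continuous hL (-1) hγ
      fun t ht ↦ by simpa using neg_nullComplex_mem_slitPlane (hle t ht)).symm
  induction h with
  | single h => exact key h hr
  | tail _ h ih => exact ⟨(key h ih.1).1, (key h ih.1).2.trans ih.2⟩

/-- Over a simply connected covering, no pair of points over `p` and `q` satisfies both closure
relations, since the timelike curves involved pass on different sides of the origin. -/
theorem notMem_closure_chronPast
    (hf : Spacetime.IsUniversalLorentzCovering S puncturedMinkowski f) {p' q' : N}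
    (hp : f p' = pointP) (hq : f q' = pointQ) (h : q' ∈ closure (S.chronFuture p')) :
    p' ∉ closure (S.chronPast q') := by
  intro h'
  have := hf.simplyConnected
  have : LocallyPathConnectedSpace N := ChartedSpace.locallyPathConnectedSpace Plane N
  have hfc := hf.isCoveringMap.continuous
  obtain ⟨L, hL⟩ := exists_exp_eq_nullComplex hfc
  have hu : Continuous fun n ↦ nullComplex (f n) :=
    continuous_nullComplex.comp (continuous_subtype_val.comp hfc)
  have hp0 : (pointP : Plane) 0 + (pointP : Plane) 1 = 0 := by simp [pointP]
  have hq0 : (pointQ : Plane) 0 + (pointQ : Plane) 1 = 0 := by simp [pointQ]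
  have h1 := eq_of_mem_closure_of_forall_eq (g := fun n ↦ L n - Complex.log (nullComplex (f n)))
    (L.continuous.continuousAt.sub (hu.continuousAt.clog
      (nullComplex_mem_slitPlane (by rw [hp, hp0])))) h'
    fun z hz ↦ (sub_log_eq_of_chron_of_nonpos hf.toIsLorentzCovering hL hz (by rw [hq, hq0])).2
  have h2 := eq_of_mem_closure_of_forall_eq (g := fun n ↦ L n - Complex.log (-nullComplex (f n)))
    (L.continuous.continuousAt.sub (hu.neg.continuousAt.clog
      (neg_nullComplex_mem_slitPlane (by rw [hq, hq0])))) h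
    fun z hz ↦
      (sub_log_neg_eq_of_chron_of_nonneg hf.toIsLorentzCovering hL hz (by rw [hp, hp0])).2
  simp only [hp, hq, nullComplex_pointP, nullComplex_pointQ, neg_neg] at h1 h2
  -- `h1` and `h2` evaluate L(p') - L(q') as log(2i) - log(-2i) and as its negative, so the
  -- difference vanishes.
  have h3 : Complex.log (2 * Complex.I) = Complex.log (-(2 * Complex.I)) := by
    linear_combination -(h1 + h2) / 2
  have h4 := congrArg Complex.exp h3
  rw [Complex.exp_log (by simp), Complex.exp_log (by simp)] at h4
  have := congrArg Complex.im h4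
  norm_num at this

end Lift

/-! ### Lifting timelike segments that pass on one side of the holes. -/

/-- The plane without the half-line `t = 0`, `x ≤ 0`. -/
def slitRegion : Set Plane := {v | v 0 ≠ 0 ∨ 0 < v 1}

theorem isOpen_slitRegion : IsOpen slitRegion :=
  (isOpen_ne_fun (f := fun v : Plane ↦ v 0) (by fun_prop) continuous_const).union
    (isOpen_lt (g := fun v : Plane ↦ v 1) continuous_const (by fun_prop))

theorem slitRegion_subset : slitRegion ⊆ puncturedPlane := by
  rintro v hv (h | ⟨k, hk, h⟩)
  · simp [slitRegion, show v = _ from h] at hv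
  · rw [h] at hv
    rcases hv with hv | hv
    · simp at hv
    · have : (0 : ℝ) < -1 / (k : ℝ) := by simpa using hv
      exact absurd this (not_lt.2 (div_nonpos_of_nonpos_of_nonneg (by norm_num) k.cast_nonneg))

theorem starConvex_slitRegion : StarConvex ℝ !₂[0, 1] slitRegion := by
  intro v hv b c hb hc hbc
  simp only [slitRegion, mem_ofPred_eq, PiLp.add_apply, PiLp.smul_apply, Matrix.cons_val_zero,
    Matrix.cons_val_one, smul_eq_mul, mul_zero, zero_add, mul_one] at hv ⊢
  rcases hc.eq_or_lt with rfl | hc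
  · right
    linarith
  · rcases hv with hv | hv
    · exact Or.inl (mul_ne_zero hc.ne' hv)
    · exact Or.inr (by positivity)

/-- Along this segment t + x = sε, so it crosses t = 0 at a point with x > 0. For ε = 0 it would run
into the origin. -/
theorem lineMap_mem_slitRegion {ε s : ℝ} (hε : 0 < ε) (hs : s ∈ Icc (0 : ℝ) 1) :
    AffineMap.lineMap (pointP : Plane) !₂[1 + ε, -1] s ∈ slitRegion := by
  simp only [slitRegion, mem_ofPred_eq, AffineMap.lineMap_apply, vsub_eq_sub, vadd_eq_add,
    PiLp.add_apply, PiLp.smul_apply, PiLp.sub_apply, pointP, Matrix.cons_val_zero,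
    Matrix.cons_val_one, smul_eq_mul]
  by_contra! h
  have : 0 ≤ s * ε := mul_nonneg hs.1 hε.le
  have h0 : s * ε = 0 := by linarith [h.1, h.2]
  rcases mul_eq_zero.1 h0 with rfl | h0
  · norm_num at h
  · exact hε.ne' h0

/-- The slit region is star-shaped, hence contractible, and contains no hole, so its inclusion lifts
to any covering with prescribed value over p. -/
theorem exists_section_slitRegion {N : Type*} [TopologicalSpace N]
    {f : N → puncturedPlane} (hf : IsCoveringMap f) {p' : N} (hp : f p' = pointP) :
    ∃ σ : C(slitRegion, N), (∀ w, (f (σ w) : Plane) = w) ∧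
      ∀ w : slitRegion, (w : Plane) = pointP → σ w = p' := by
  have := starConvex_slitRegion.contractibleSpace ⟨!₂[0, 1], by simp [slitRegion]⟩
  have := isOpen_slitRegion.locallyPathConnectedSpace
  obtain ⟨σ, ⟨hσ, hσf⟩, -⟩ := hf.existsUnique_continuousMap_lifts
    (⟨Set.inclusion slitRegion_subset, continuous_inclusion _⟩ : C(slitRegion, puncturedPlane))
    (⟨pointP, by simp [slitRegion, pointP]⟩ : slitRegion) p' hp
  exact ⟨σ, fun w ↦ congrArg Subtype.val (congrFun hσf w), fun w hw ↦ by
    rw [← hσ]; exact congrArg σ (Subtype.ext hw)⟩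

variable {N : Type*} [TopologicalSpace N] [ChartedSpace Plane N] [IsManifold 𝓘(ℝ, Plane) ∞ N]
  {S : Spacetime Plane N} {f : N → puncturedPlane}

theorem exists_mem_closure_chronFuture
    (hf : Spacetime.IsLorentzCovering S puncturedMinkowski f) {p' : N} (hp : f p' = pointP) :
    ∃ q' : N, f q' = pointQ ∧ q' ∈ closure (S.chronFuture p') := by
  obtain ⟨σ, hσ, hσp⟩ := exists_section_slitRegion hf.isCoveringMap hp
  have hmem (ε : ℝ) (hε : 0 ≤ ε) : (!₂[1 + ε, -1] : Plane) ∈ slitRegion :=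
    Or.inl (by simpa using (by positivity : 1 + ε ≠ 0))
  -- The value ε = 0 gives q, which lies in the slit region although the segment from p to q does
  -- not; its lift is the limit of lifts lying in the future of p'.
  let e : Ici (0 : ℝ) → slitRegion := fun ε ↦ ⟨!₂[1 + ε, -1], hmem ε ε.2⟩
  have he : Continuous e := by fun_prop
  refine ⟨σ (e ⟨0, self_mem_Ici⟩), Subtype.ext ?_, ?_⟩
  · rw [hσ]
    simp [e, pointQ]
  · have h0 : (⟨0, self_mem_Ici⟩ : Ici (0 : ℝ)) ∈ closure {ε : Ici (0 : ℝ) | 0 < (ε : ℝ)} := by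
      rw [closure_subtype]
      have : Subtype.val '' {ε : Ici (0 : ℝ) | 0 < (ε : ℝ)} = Ioi 0 := by
        ext x
        exact ⟨fun ⟨y, hy, hyx⟩ ↦ hyx ▸ hy, fun hx ↦ ⟨⟨x, Ioi_subset_Ici_self hx⟩, hx, rfl⟩⟩
      rw [this, closure_Ioi]
      exact self_mem_Ici
    refine closure_mono ?_ (mem_closure_image (f := σ ∘ e) (σ.continuous.comp he).continuousAt h0)
    rintro _ ⟨ε, hε, rfl⟩
    -- Clamping s to [0, 1] makes the lifted segment a continuous function on all of ℝ.
    let γ : ℝ → N := fun s ↦ σ ⟨AffineMap.lineMap (pointP : Plane) !₂[1 + (ε : ℝ), -1]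
      (projIcc (0 : ℝ) 1 zero_le_one s : ℝ), lineMap_mem_slitRegion hε (Subtype.prop _)⟩
    have hγc : Continuous γ := by
      refine σ.continuous.comp (Continuous.subtype_mk ?_ _)
      exact AffineMap.lineMap_continuous.comp (continuous_subtype_val.comp continuous_projIcc)
    have hγ : S.IsTimelikeCurveOn γ 0 1 := by
      refine hf.isTimelikeCurveOn_of_comp hγc.continuousOn
        (isTimelikeCurveOn_of_eqOn_lineMap (a := pointP) (b := !₂[1 + (ε : ℝ), -1]) ?_
          fun s hs ↦ ?_)
      · have : (0 : ℝ) < ε := hε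
        simp only [MinkowskiChron, pointP, Matrix.cons_val_zero, Matrix.cons_val_one]
        rw [abs_lt]
        constructor <;> linarith
      · simp only [γ, Function.comp_apply, hσ, projIcc_of_mem _ hs]
    have h0 : γ 0 = p' := hσp _ (by simp)
    have h1 : γ 1 = σ (e ε) := congrArg σ (Subtype.ext (by simp [e]))
    rw [← h0, Function.comp_apply, ← h1]
    exact .single hγ.smoothTimelikeCurve

end

theorem mainTheorem4 :
    ConnectedSpace puncturedPlane ∧
    puncturedMinkowski.CausallyContinuous ∧
    puncturedMinkowski.Reflecting ∧
    pointQ ∈ closure (puncturedMinkowski.chronFuture pointP) ∧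
    pointP ∈ closure (puncturedMinkowski.chronPast pointQ) ∧
    ∀ (N : Type*) [TopologicalSpace N] [ChartedSpace Plane N] [IsManifold 𝓘(ℝ, Plane) ∞ N]
      (S : Spacetime Plane N) (f : N → puncturedPlane),
      Spacetime.IsUniversalLorentzCovering S puncturedMinkowski f →
        (∀ p' : N, f p' = pointP → ∃ q' : N, f q' = pointQ ∧
          q' ∈ closure (S.chronFuture p') ∧ p' ∉ closure (S.chronPast q')) ∧
        ¬ S.PastReflecting := by
  have hU := countable_compl_puncturedPlane
  refine ⟨connectedSpace_puncturedPlane, minkowskiOn_causallyContinuous hU,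
    minkowskiOn_reflecting hU, (mem_closure_chronFuture_iff hU).2 minkowskiCausal_pointP_pointQ,
    (mem_closure_chronPast_iff hU).2 minkowskiCausal_pointP_pointQ, fun N _ _ _ S f hf ↦ ?_⟩
  have key (p' : N) (hp : f p' = pointP) : ∃ q' : N, f q' = pointQ ∧
      q' ∈ closure (S.chronFuture p') ∧ p' ∉ closure (S.chronPast q') := by
    obtain ⟨q', hq, hq'⟩ := exists_mem_closure_chronFuture hf.toIsLorentzCovering hp
    exact ⟨q', hq, hq', notMem_closure_chronPast hf hp hq hq'⟩
  refine ⟨key, fun hS ↦ ?_⟩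
  obtain ⟨p', hp⟩ := hf.surjective pointP
  obtain ⟨q', -, hq, hpq⟩ := key p' hp
  exact hpq (hS p' q' hq)
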